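/- Let $n\ge 1$, let $c_0,\dots,c_{n-1}$ be real numbers, and let $$f(\lambda)=\lambda_1\cdots\lambda_n-\sum_{k=0}^{n-1}c_k\,\sigma_k(\lambda),\qquad \lambda\in\mathbb{R}^n,$$ where $\sigma_k$ is the $k$-th elementary symmetric polynomial ($\sigma_0=1$). Let $$r_f(x)=f(x,\dots,x)=x^n-\sum_{k=0}^{n-1}c_k\binom{n}{k}x^k$$ be its diagonal restriction, and let $\Gamma_n=\{\lambda\in\mathbb{R}^n:\lambda_i>0 \text{ for all } i\}$. A connected component $\Gamma$ of $\{f>0\}\subset\mathbb{R}^n$ is called $\Upsilon$-stable if $\Gamma\subseteq q+\Gamma_n$ for some $q\in\mathbb{R}^n$. Its $\Upsilon_1$-cone is the set of all $\mu\in\mathbb{R}^n$ such that, for every permutation $s$ of $\{1,\dots,n\}$, the point $(\mu_{s(1)},\dots,\mu_{s(n-1)})$ lies in the projection of $\Gamma$ to $\mathbb{R}^{n-1}$ that drops the last entry (for $n=1$ this is all of $\mathbb{R}$). The component $\Gamma$ is called strictly $\Upsilon$-stable if it is $\Upsilon$-stable and its boundary $\partial\Gamma$ is contained in its $\Upsilon_1$-cone.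 A real polynomial $p$ of degree $n$ is called right-Noetherian if for every $k\in\{0,\dots,n-1\}$ the derivative $p^{(k)}$ has a real root which is greater than or equal to every real root of $p^{(k+1)}$. It is called strictly right-Noetherian if, in addition, $p$ has a real root which is strictly greater than every real root of $p'$. Then $\{f>0\}$ has a connected component which is $\Upsilon$-stable if and only if $r_f$ is right-Noetherian. Moreover, an $\Upsilon$-stable connected component of $\{f>0\}$ is strictly $\Upsilon$-stable if and only if $r_f$ is strictly right-Noetherian. -/

import Mathlib

namespace InverseSigma

/-- The general inverse `σ_k` type multilinear polynomial
`λ_1 ⋯ λ_n - ∑_{k=0}^{n-1} c_k σ_k(λ)` in `n` variables, with real coefficients `c_0, …, c_{n-1}`. -/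
noncomputable def poly (n : ℕ) (c : Fin n → ℝ) : MvPolynomial (Fin n) ℝ :=
  ∏ i, MvPolynomial.X i
    - ∑ k : Fin n, MvPolynomial.C (c k) * MvPolynomial.esymm (Fin n) ℝ (k : ℕ)

/-- The diagonal restriction `r_f(x) = f(x, …, x)`, as a univariate polynomial. -/
noncomputable def diagRestriction {n : ℕ} (f : MvPolynomial (Fin n) ℝ) : Polynomial ℝ :=
  MvPolynomial.aeval (fun _ => Polynomial.X) f

/-- `r_f(x) = x^n - ∑_{k=0}^{n-1} c_k (n choose k) x^k`. -/
theorem diagRestriction_poly (n : ℕ) (c : Fin n → ℝ) :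
    diagRestriction (poly n c) = Polynomial.X ^ n
      - ∑ k : Fin n, Polynomial.C (c k * (n.choose k : ℝ)) * Polynomial.X ^ (k : ℕ) := by
  unfold diagRestriction poly
  simp only [map_sub, map_prod, map_sum, map_mul, MvPolynomial.aeval_X, Finset.prod_const,
    Finset.card_univ, Fintype.card_fin, MvPolynomial.algHom_C, MvPolynomial.aeval_esymm_eq_multiset_esymm]
  congr 1
  refine Finset.sum_congr rfl fun k _ => ?_
  rw [Finset.esymm_map_val]
  rw [Finset.sum_congr rfl (g := fun _ => (Polynomial.X : Polynomial ℝ) ^ (k : ℕ))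
    (fun s hs => by rw [Finset.prod_const, (Finset.mem_powersetCard.1 hs).2])]
  simp [Finset.sum_const, Finset.card_powersetCard, mul_assoc]

/-- The open set `{f > 0}` in `ℝ^n`. -/
def posSet {n : ℕ} (f : MvPolynomial (Fin n) ℝ) : Set (Fin n → ℝ) :=
  {x | 0 < MvPolynomial.eval x f}

/-- `G` is a connected component of the set `S` (in particular, `G` is nonempty). -/
def IsConnComponent {X : Type*} [TopologicalSpace X] (S G : Set X) : Prop :=
  ∃ x ∈ S, G = connectedComponentIn S x

/-- The (open) positive orthant `Γ_n` of `ℝ^n`. -/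
def positiveOrthant (n : ℕ) : Set (Fin n → ℝ) :=
  {x | ∀ i, 0 < x i}

/-- `G` is contained in a translate `q + Γ_n` of the positive orthant. -/
def UpsilonStable {n : ℕ} (G : Set (Fin n → ℝ)) : Prop :=
  ∃ q : Fin n → ℝ, G ⊆ (fun x => q + x) '' positiveOrthant n

/-- The projection `ℝ^n → ℝ^{n-k}` that drops the last `k` entries. -/
def dropLast {n : ℕ} (k : ℕ) (x : Fin n → ℝ) : Fin (n - k) → ℝ :=
  fun i => x (Fin.castLE (Nat.sub_le n k) i)

/-- The `Υ_k`-cone of `G`: all `μ` such that `(μ_{s(1)}, …, μ_{s(n-k)})` lies in the projection of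
`G` to `ℝ^{n-k}` for every permutation `s`. -/
def upsilonCone {n : ℕ} (k : ℕ) (G : Set (Fin n → ℝ)) : Set (Fin n → ℝ) :=
  {μ | ∀ s : Equiv.Perm (Fin n), dropLast k (fun i => μ (s i)) ∈ dropLast k '' G}

/-- `G` is `Υ`-stable and its boundary lies in the `Υ_1`-cone of `G`. -/
def StrictlyUpsilonStable {n : ℕ} (G : Set (Fin n → ℝ)) : Prop :=
  UpsilonStable G ∧ frontier G ⊆ upsilonCone 1 G

/-- For each `k < deg p`, some real root of `p^{(k)}` is at least as large as every real root of
`p^{(k+1)}` (no condition if `p^{(k+1)}` is a nonzero constant, i.e. `k = deg p - 1`). -/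
def RightNoetherian (p : Polynomial ℝ) : Prop :=
  ∀ k < p.natDegree, ∃ x : ℝ, (Polynomial.derivative^[k] p).IsRoot x ∧
    ∀ y : ℝ, (Polynomial.derivative^[k + 1] p).IsRoot y → y ≤ x

/-- `p` is right-Noetherian and some (equivalently, the largest) real root of `p` is strictly
greater than every real root of `p'`. -/
def StrictlyRightNoetherian (p : Polynomial ℝ) : Prop :=
  RightNoetherian p ∧
    ∃ x : ℝ, p.IsRoot x ∧ ∀ y : ℝ, (Polynomial.derivative p).IsRoot y → y < x

end InverseSigma

open Finset Filter Topology

set_option linter.unusedSectionVars false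

namespace InverseSigma

variable {ι : Type*} [DecidableEq ι]

/-! Since `f` is affine in each variable, its partial derivatives are the `blossom b T`, with
diagonal restrictions `appell b #T`; up to constants these are the derivatives of `r_f`. An Υ-stable
component can only be the set `PosOn b univ` where all these derivatives are positive
(`IsConnComponent.eq_posOn`): a nonpositive slope in some variable would let that variable decrease
forever inside the component. Conversely this set is open, connected and bounded below, so it is an
Υ-stable component once it is relatively closed in `{f > 0}`, which is `StableOn`.

Stability is then read off the diagonal. If it holds, it passes to all partial derivatives
(`StableOn.mono`), and the diagonal endpoint of each positivity region is the required root
(`StableOn.exists_root`). For the converse, stability could only fail where a first derivative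
vanishes. On that hypersurface `f` is largest at the diagonal point (`StableOn.blossom_insert_le`,
by symmetrizing pairs of coordinates), and there the ordering of the roots makes it nonpositive. The
same bound, with a strict inequality of roots, settles strict stability. -/

/-- The symmetric multi-affine polynomial `∑_{T ⊆ U} b_{|U| - |T|} ∏_{i ∈ T} x_i` in the variables
indexed by `U`. Its partial derivatives are obtained by shrinking `U`. -/
noncomputable def blossom (b : ℕ → ℝ) (U : Finset ι) (x : ι → ℝ) : ℝ :=
  ∑ T ∈ U.powerset, b (#U - #T) * ∏ i ∈ T, x i

/-- The diagonal restriction of `blossom`; these form an Appell sequence. -/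
noncomputable def appell (b : ℕ → ℝ) (m : ℕ) (x : ℝ) : ℝ :=
  ∑ k ∈ range (m + 1), (m.choose k : ℝ) * (b (m - k) * x ^ k)

/-- All partial derivatives of `blossom b U`, including itself, are positive at `x`. -/
def PosOn (b : ℕ → ℝ) (U : Finset ι) (x : ι → ℝ) : Prop :=
  ∀ T ⊆ U, 0 < blossom b T x

/-- All partial derivatives of `blossom b U`, including itself, are nonnegative at `x`. -/
def NonnegOn (b : ℕ → ℝ) (U : Finset ι) (x : ι → ℝ) : Prop :=
  ∀ T ⊆ U, 0 ≤ blossom b T x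

/-- The region `PosOn b U` is relatively closed in the region where `blossom b U` is positive. -/
def StableOn (b : ℕ → ℝ) (U : Finset ι) : Prop :=
  ∀ x, NonnegOn b U x → 0 < blossom b U x → PosOn b U x

/-! ### Multi-affine calculus: recursion, Taylor expansion, positivity regions. -/

theorem blossom_const (b : ℕ → ℝ) (U : Finset ι) (x : ℝ) :
    blossom b U (fun _ => x) = appell b #U x := by
  simp only [blossom, prod_const]
  rw [Finset.sum_powerset_apply_card (fun k => b (#U - k) * x ^ k)]
  simp [appell]

theorem blossom_congr (b : ℕ → ℝ) {U : Finset ι} {x y : ι → ℝ} (h : ∀ i ∈ U, x i = y i) :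
    blossom b U x = blossom b U y := by
  refine sum_congr rfl fun T hT => ?_
  rw [prod_congr rfl fun i hi => h i (mem_powerset.1 hT hi)]

theorem blossom_empty (b : ℕ → ℝ) (x : ι → ℝ) : blossom b ∅ x = b 0 := by
  simp [blossom]

theorem blossom_insert (b : ℕ → ℝ) {U : Finset ι} {i : ι} (hi : i ∉ U) (x : ι → ℝ) :
    blossom b (insert i U) x
      = x i * blossom b U x + blossom (fun k => b (k + 1)) U x := by
  unfold blossom
  rw [sum_powerset_insert hi, add_comm, mul_sum]
  congr 1
  · refine sum_congr rfl fun T hT => ?_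
    have hiT : i ∉ T := fun h => hi (mem_powerset.1 hT h)
    rw [prod_insert hiT, card_insert_of_notMem hi, card_insert_of_notMem hiT,
      Nat.add_sub_add_right]
    ring
  · refine sum_congr rfl fun T hT => ?_
    rw [card_insert_of_notMem hi, Nat.sub_add_comm (card_le_card (mem_powerset.1 hT))]

theorem blossom_singleton (b : ℕ → ℝ) (i : ι) (x : ι → ℝ) :
    blossom b {i} x = x i * b 0 + b 1 := by
  rw [← insert_empty_eq, blossom_insert b (notMem_empty i), blossom_empty, blossom_empty]

theorem blossom_update_of_notMem (b : ℕ → ℝ) {U : Finset ι} {i : ι} (hi : i ∉ U) (x : ι → ℝ)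
    (t : ℝ) : blossom b U (Function.update x i t) = blossom b U x :=
  blossom_congr b fun _ hj => Function.update_of_ne (ne_of_mem_of_not_mem hj hi) _ _

theorem blossom_insert_update (b : ℕ → ℝ) {U : Finset ι} {i : ι} (hi : i ∉ U) (x : ι → ℝ)
    (t : ℝ) : blossom b (insert i U) (Function.update x i t)
      = t * blossom b U x + blossom (fun k => b (k + 1)) U x := by
  rw [blossom_insert b hi, blossom_update_of_notMem b hi, blossom_update_of_notMem _ hi,
    Function.update_self]

@[fun_prop]
theorem continuous_blossom (b : ℕ → ℝ) (U : Finset ι) : Continuous (blossom b U) := by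
  unfold blossom
  fun_prop

@[fun_prop]
theorem continuous_appell (b : ℕ → ℝ) (m : ℕ) : Continuous (appell b m) := by
  unfold appell
  fun_prop

theorem blossom_map (b : ℕ → ℝ) {κ : Type*} [DecidableEq κ] (e : κ ↪ ι) (U : Finset κ)
    (x : ι → ℝ) : blossom b (U.map e) x = blossom b U (x ∘ e) := by
  induction U using Finset.induction_on generalizing b with
  | empty => simp [blossom_empty]
  | insert i U hi ih =>
    rw [map_insert, blossom_insert b (by simpa using hi), blossom_insert b hi, ih, ih]
    rfl

/-- Taylor expansion of `blossom`. -/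
theorem blossom_add (b : ℕ → ℝ) (U : Finset ι) (x v : ι → ℝ) :
    blossom b U (x + v) = ∑ T ∈ U.powerset, blossom b T x * ∏ i ∈ U \ T, v i := by
  induction U using Finset.induction_on generalizing b with
  | empty => simp [blossom_empty]
  | insert i U hi ih =>
    rw [blossom_insert b hi, ih, ih, sum_powerset_insert hi, Pi.add_apply, add_mul, mul_sum,
      mul_sum, add_right_comm, ← sum_add_distrib, add_comm]
    congr 1
    · refine sum_congr rfl fun T hT => ?_
      have hiT : i ∉ T := fun h => hi (mem_powerset.1 hT h)
      rw [insert_sdiff_of_notMem _ hiT, prod_insert (by simp [hi])]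
      ring
    · refine sum_congr rfl fun T hT => ?_
      have hiT : i ∉ T := fun h => hi (mem_powerset.1 hT h)
      rw [blossom_insert b hiT, insert_sdiff_insert, sdiff_insert_of_notMem hi]
      ring

/-- In the Taylor expansion the terms `T = U` and `T = ∅` give the left side; all the others are
nonnegative. -/
theorem blossom_add_ge {b : ℕ → ℝ} (hb : b 0 = 1) {U : Finset ι} (hU : U.Nonempty)
    {x v : ι → ℝ} (hx : ∀ T ⊂ U, 0 ≤ blossom b T x) (hv : ∀ i ∈ U, 0 ≤ v i) :
    blossom b U x + ∏ i ∈ U, v i ≤ blossom b U (x + v) := by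
  rw [blossom_add]
  have h : ∑ T ∈ {U, ∅}, blossom b T x * ∏ i ∈ U \ T, v i
      = blossom b U x + ∏ i ∈ U, v i := by
    rw [sum_pair hU.ne_empty]
    simp [blossom_empty, hb]
  rw [← h]
  refine sum_le_sum_of_subset_of_nonneg (by simp [insert_subset_iff]) fun T hT hT' => ?_
  have hTU : T ≠ U := fun h => hT' (by simp [h])
  exact mul_nonneg (hx T ((mem_powerset.1 hT).ssubset_of_ne hTU))
    (prod_nonneg fun i hi => hv i (mem_sdiff.1 hi).1)

theorem NonnegOn.mono {b : ℕ → ℝ} {U V : Finset ι} {x : ι → ℝ} (h : NonnegOn b V x)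
    (hU : U ⊆ V) : NonnegOn b U x := fun T hT => h T (hT.trans hU)

theorem PosOn.mono {b : ℕ → ℝ} {U V : Finset ι} {x : ι → ℝ} (h : PosOn b V x)
    (hU : U ⊆ V) : PosOn b U x := fun T hT => h T (hT.trans hU)

theorem PosOn.nonnegOn {b : ℕ → ℝ} {U : Finset ι} {x : ι → ℝ} (h : PosOn b U x) :
    NonnegOn b U x := fun T hT => (h T hT).le

theorem NonnegOn.le_add {b : ℕ → ℝ} (hb : b 0 = 1) {U : Finset ι} {x v : ι → ℝ}
    (h : NonnegOn b U x) (hv : ∀ i ∈ U, 0 ≤ v i) :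
    blossom b U x ≤ blossom b U (x + v) := by
  rcases U.eq_empty_or_nonempty with rfl | hU
  · simp [blossom_empty]
  · have := blossom_add_ge hb hU (fun T hT => h T hT.subset) hv
    linarith [prod_nonneg hv]

theorem NonnegOn.posOn_add {b : ℕ → ℝ} (hb : b 0 = 1) {U : Finset ι} {x v : ι → ℝ}
    (h : NonnegOn b U x) (hv : ∀ i ∈ U, 0 < v i) : PosOn b U (x + v) := by
  intro T hT
  rcases T.eq_empty_or_nonempty with rfl | hU
  · simp [blossom_empty, hb]
  · have := blossom_add_ge hb hU (fun S hS => h S (hS.subset.trans hT))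
      (fun i hi => (hv i (hT hi)).le)
    linarith [prod_pos fun i hi => hv i (hT hi), h T hT]

theorem PosOn.add {b : ℕ → ℝ} (hb : b 0 = 1) {U : Finset ι} {x v : ι → ℝ}
    (h : PosOn b U x) (hv : ∀ i ∈ U, 0 ≤ v i) : PosOn b U (x + v) := fun T hT =>
  (h T hT).trans_le ((h.nonnegOn.mono hT).le_add hb fun i hi => hv i (hT hi))

theorem isOpen_posOn (b : ℕ → ℝ) (U : Finset ι) : IsOpen {x | PosOn b U x} := by
  have : {x : ι → ℝ | PosOn b U x} = ⋂ T ∈ U.powerset, {x | 0 < blossom b T x} := by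
    ext x; simp [PosOn]
  rw [this]
  exact isOpen_biInter_finset fun T _ => isOpen_lt continuous_const (continuous_blossom b T)

theorem isClosed_nonnegOn (b : ℕ → ℝ) (U : Finset ι) : IsClosed {x | NonnegOn b U x} := by
  have : {x : ι → ℝ | NonnegOn b U x} = ⋂ T ∈ U.powerset, {x | 0 ≤ blossom b T x} := by
    ext x; simp [NonnegOn]
  rw [this]
  exact isClosed_biInter fun T _ => isClosed_le continuous_const (continuous_blossom b T)

theorem closure_posOn_subset (b : ℕ → ℝ) (U : Finset ι) :
    closure {x | PosOn b U x} ⊆ {x | NonnegOn b U x} :=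
  closure_minimal (fun _ hx => hx.nonnegOn) (isClosed_nonnegOn b U)

/-- Stability makes `PosOn b U` clopen in the positivity set, so a connected set on which `blossom b
U` is positive cannot leave it. Every use of stability along a path goes through this. -/
theorem StableOn.subset_of_isPreconnected {b : ℕ → ℝ} {U : Finset ι} (h : StableOn b U)
    {S : Set (ι → ℝ)} (hS : IsPreconnected S) (hpos : ∀ x ∈ S, 0 < blossom b U x)
    {x : ι → ℝ} (hx : x ∈ S) (hxU : PosOn b U x) : ∀ y ∈ S, PosOn b U y :=
  hS.subset_of_closure_inter_subset (isOpen_posOn b U) ⟨x, hx, hxU⟩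
    fun y hy => h y (closure_posOn_subset b U hy.1) (hpos y hy.2)

/-! ### The diagonal -/

theorem appell_zero (b : ℕ → ℝ) (x : ℝ) : appell b 0 x = b 0 := by simp [appell]

theorem appell_one (b : ℕ → ℝ) (x : ℝ) : appell b 1 x = x * b 0 + b 1 := by
  simp [appell, sum_range_succ, mul_comm, add_comm]

theorem appell_add_ge {b : ℕ → ℝ} (hb : b 0 = 1) {m : ℕ} {x y : ℝ}
    (hx : ∀ j ≤ m, 0 ≤ appell b j x) (hxy : x ≤ y) :
    appell b (m + 1) x + (y - x) ^ (m + 1) ≤ appell b (m + 1) y := by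
  have := blossom_add_ge (U := range (m + 1)) (x := fun _ => x) (v := fun _ => y - x) hb (by simp)
    (fun T hT => by
      rw [blossom_const]
      exact hx _ (by simpa [Nat.lt_succ_iff] using card_lt_card hT))
    (fun _ _ => sub_nonneg.2 hxy)
  have e : ((fun _ => x) + fun _ => y - x : ℕ → ℝ) = fun _ => y := by ext; simp
  rw [e] at this
  simpa [blossom_const] using this

theorem appell_mono {b : ℕ → ℝ} (hb : b 0 = 1) {m : ℕ} {x y : ℝ}
    (hx : ∀ j ≤ m, 0 ≤ appell b j x) (hxy : x ≤ y) : appell b m x ≤ appell b m y := by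
  cases m with
  | zero => simp [appell_zero]
  | succ m =>
    have := appell_add_ge hb (fun j hj => hx j (hj.trans m.le_succ)) hxy
    linarith [pow_nonneg (sub_nonneg.2 hxy) (m + 1)]

theorem appell_pos_of_lt {b : ℕ → ℝ} (hb : b 0 = 1) {m : ℕ} {x y : ℝ}
    (hx : ∀ j ≤ m, 0 ≤ appell b j x) (hxy : x < y) : 0 < appell b m y := by
  cases m with
  | zero => simp [appell_zero, hb]
  | succ m =>
    have := appell_add_ge hb (fun j hj => hx j (hj.trans m.le_succ)) hxy.le
    linarith [pow_pos (sub_pos.2 hxy) (m + 1), hx (m + 1) le_rfl]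

theorem exists_appell_pos {b : ℕ → ℝ} (hb : b 0 = 1) (m : ℕ) :
    ∃ x, ∀ j ≤ m, 0 < appell b j x := by
  induction m with
  | zero => exact ⟨0, fun j hj => by simp [Nat.le_zero.1 hj, appell_zero, hb]⟩
  | succ m ih =>
    obtain ⟨x, hx⟩ := ih
    -- As `t ≥ 1`, the gain `t ^ (m + 1)` is at least `t`, which exceeds the possible deficit of
    -- `appell b (m + 1) x`.
    set t := 1 + |appell b (m + 1) x|
    have ht : 1 ≤ t := by simp [t]
    refine ⟨x + t, fun j hj => ?_⟩
    rcases hj.lt_or_eq with hj | rfl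
    · exact appell_pos_of_lt hb (fun k hk => (hx k (by lia)).le) (by linarith)
    · have := appell_add_ge hb (fun k hk => (hx k hk).le) (show x ≤ x + t by linarith)
      rw [add_sub_cancel_left] at this
      have h2 : t ≤ t ^ (m + 1) := le_self_pow₀ ht (by simp)
      have h3 := neg_abs_le (appell b (m + 1) x)
      simp only [t] at *
      linarith

/-! ### Symmetrizing two coordinates and the diagonal bound. -/

theorem blossom_insert_insert (b : ℕ → ℝ) {W : Finset ι} {i j : ι} (hij : i ≠ j) (hi : i ∉ W)
    (hj : j ∉ W) (x : ι → ℝ) :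
    blossom b (insert i (insert j W)) x = x i * x j * blossom b W x
      + (x i + x j) * blossom (fun k => b (k + 1)) W x
      + blossom (fun k => b (k + 1 + 1)) W x := by
  rw [blossom_insert b (by simp [hij, hi]), blossom_insert b hj, blossom_insert _ hj]
  ring

/-- In the two variables the polynomial is `A x_i x_j + B (x_i + x_j) + C`. If `A C > B ^ 2`,
lowering `x_i` to `-B / A` keeps it positive, yet its `x_j`-derivative `A x_i + B` vanishes there,
against stability. -/
theorem StableOn.discriminant_nonneg {b : ℕ → ℝ} {W : Finset ι} {i j : ι} (hij : i ≠ j)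
    (hi : i ∉ W) (hj : j ∉ W) (h : StableOn b (insert i (insert j W))) {x : ι → ℝ}
    (hx : PosOn b (insert i (insert j W)) x) :
    blossom b W x * blossom (fun k => b (k + 1 + 1)) W x
      ≤ blossom (fun k => b (k + 1)) W x ^ 2 := by
  by_contra! hlt
  have hA : 0 < blossom b W x := hx W ((subset_insert _ _).trans (subset_insert _ _))
  have hi' := hx (insert i W) (insert_subset_insert _ (subset_insert _ _))
  have hj' := hx (insert j W) (subset_insert _ _)
  rw [blossom_insert b hi] at hi'
  rw [blossom_insert b hj] at hj'
  set A := blossom b W x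
  set B := blossom (fun k => b (k + 1)) W x
  set C := blossom (fun k => b (k + 1 + 1)) W x
  have hle : -B / A ≤ x i := by rw [div_le_iff₀ hA]; linarith
  have hS : IsPreconnected ((fun t => Function.update x i t) '' Set.Icc (-B / A) (x i)) :=
    isPreconnected_Icc.image _ (by fun_prop)
  have key := h.subset_of_isPreconnected hS (x := x) ?_
    ⟨x i, ⟨hle, le_rfl⟩, Function.update_eq_self _ _⟩ hx
    (Function.update x i (-B / A)) ⟨_, ⟨le_rfl, hle⟩, rfl⟩
  · have := key (insert i W) (insert_subset_insert _ (subset_insert _ _))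
    rw [blossom_insert_update b hi] at this
    change 0 < -B / A * A + B at this
    rw [div_mul_cancel₀ _ hA.ne'] at this
    linarith
  · rintro _ ⟨t, ht, rfl⟩
    dsimp only
    rw [blossom_insert_update b (by simp [hij, hi]), blossom_insert b hj, blossom_insert _ hj]
    change 0 < t * (x j * A + B) + (x j * B + C)
    have h1 : 0 ≤ (t - -B / A) * (x j * A + B) := mul_nonneg (sub_nonneg.2 ht.1) hj'.le
    have h2 : 0 < (A * C - B ^ 2) / A := div_pos (sub_pos.2 hlt) hA
    have h3 : t * (x j * A + B) + (x j * B + C)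
        = (t - -B / A) * (x j * A + B) + (A * C - B ^ 2) / A := by
      field_simp; ring
    rw [h3]; linarith

/-- Bringing two unequal coordinates closer along a level set of `blossom b U` decreases their sum
and does not decrease `blossom b (insert i U)`. -/
theorem StableOn.exists_sum_lt {b : ℕ → ℝ} {U : Finset ι} (h : StableOn b U) {x : ι → ℝ}
    (hx : PosOn b U x) {i j l : ι} (hi : i ∉ U) (hj : j ∈ U) (hl : l ∈ U) (hjl : x j < x l) :
    ∃ y : ι → ℝ, (∀ k ∉ U, y k = x k) ∧ PosOn b U y ∧ blossom b U y = blossom b U x ∧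
      blossom b (insert i U) x ≤ blossom b (insert i U) y ∧ ∑ k ∈ U, y k < ∑ k ∈ U, x k := by
  have hne : j ≠ l := fun e => hjl.ne (by rw [e])
  obtain ⟨W, hjW, hlW, rfl⟩ : ∃ W : Finset ι, j ∉ W ∧ l ∉ W ∧ U = insert j (insert l W) := by
    refine ⟨(U.erase j).erase l, by simp, by simp, ?_⟩
    rw [insert_erase (by simp [hl, hne.symm]), insert_erase hj]
  have hd := h.discriminant_nonneg hne hjW hlW hx
  have hA : 0 < blossom b W x := hx W ((subset_insert _ _).trans (subset_insert _ _))
  have hj' := hx (insert j W) (insert_subset_insert _ (subset_insert _ _))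
  rw [blossom_insert b hjW] at hj'
  obtain ⟨A, hAdef⟩ : ∃ A, A = blossom b W x := ⟨_, rfl⟩
  obtain ⟨B, hBdef⟩ : ∃ B, B = blossom (fun k => b (k + 1)) W x := ⟨_, rfl⟩
  obtain ⟨C, hCdef⟩ : ∃ C, C = blossom (fun k => b (k + 1 + 1)) W x := ⟨_, rfl⟩
  rw [← hAdef, ← hBdef, ← hCdef] at hd
  rw [← hAdef] at hA
  rw [← hAdef, ← hBdef] at hj'
  set β := B / A with hβ
  have hBA : B = β * A := by rw [hβ, div_mul_cancel₀ _ hA.ne']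
  have hp : 0 < x j + β := by
    have : (x j + β) * A = x j * A + B := by rw [hBA]; ring
    exact pos_of_mul_pos_left (this ▸ hj') hA.le
  set p := x j + β with hpdef
  set q := x l + β with hqdef
  have hpq : p < q := by linarith
  -- With `β = B / A`, level sets in the two coordinates are hyperbolas `(x_j + β) (x_l + β) =
  -- const`. The curve `(s p, q / s)` follows one, and its sum drops for `1 < s < q / p`.
  set y : ℝ → ι → ℝ := fun s =>
    Function.update (Function.update x j (s * p - β)) l (q / s - β) with hy
  have hyj (s : ℝ) : y s j = s * p - β := by simp [hy, hne]
  have hyl (s : ℝ) : y s l = q / s - β := by simp [hy]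
  have hyk (s : ℝ) (k : ι) (hkj : k ≠ j) (hkl : k ≠ l) : y s k = x k := by
    simp [hy, hkj, hkl]
  have hy1 : y 1 = x := by
    ext k
    by_cases hkj : k = j
    · rw [hkj, hyj]; ring
    by_cases hkl : k = l
    · rw [hkl, hyl]; ring
    exact hyk 1 k hkj hkl
  have hyW (s : ℝ) (b' : ℕ → ℝ) : blossom b' W (y s) = blossom b' W x :=
    blossom_congr b' fun k hk => hyk s k (ne_of_mem_of_not_mem hk hjW)
      (ne_of_mem_of_not_mem hk hlW)
  have hcont : ContinuousAt y 1 := by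
    have h1 : ContinuousAt (fun s : ℝ => q / s - β) 1 :=
      (continuousAt_const.div continuousAt_id one_ne_zero).sub continuousAt_const
    have h2 : ContinuousAt (fun s : ℝ => Function.update x j (s * p - β)) 1 := by fun_prop
    exact h2.update l h1
  have hev : ∀ᶠ s in 𝓝[>] (1 : ℝ), PosOn b (insert j (insert l W)) (y s) := by
    refine nhdsWithin_le_nhds (hcont.eventually ((isOpen_posOn b _).mem_nhds ?_))
    rw [hy1]; exact hx
  have hev2 : ∀ᶠ s in 𝓝[>] (1 : ℝ), s < q / p :=
    nhdsWithin_le_nhds (eventually_lt_nhds ((one_lt_div hp).2 hpq))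
  obtain ⟨s, hs, hsq, hs1⟩ := (hev.and (hev2.and self_mem_nhdsWithin)).exists
  have hs1 : 1 < s := hs1
  have hs0 : 0 < s := by linarith
  rw [lt_div_iff₀ hp] at hsq
  have hsum : s * p + q / s < p + q := by
    have : p + q - (s * p + q / s) = (s - 1) * (q - s * p) / s := by field_simp; ring
    have h2 : 0 < (s - 1) * (q - s * p) / s :=
      div_pos (mul_pos (by linarith) (by linarith)) hs0
    linarith
  have hprod : (s * p) * (q / s) = p * q := by field_simp
  have hU : blossom b (insert j (insert l W)) (y s) = blossom b (insert j (insert l W)) x := by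
    rw [blossom_insert_insert b hne hjW hlW, blossom_insert_insert b hne hjW hlW, hyW, hyW, hyW,
      hyj, hyl, ← hAdef, ← hBdef, hBA]
    linear_combination A * hprod
  -- Along the hyperbola `blossom b (insert i U)` changes by `C - B β` times the change of the sum.
  -- The discriminant inequality makes this factor nonpositive.
  have hD : B * β - C ≥ 0 := by
    have h1 : A * (B * β - C) = B ^ 2 - A * C := by rw [hBA]; ring
    exact nonneg_of_mul_nonneg_right (by rw [h1]; linarith) hA
  refine ⟨y s, fun k hk => ?_, hs, hU, ?_, ?_⟩
  · simp only [mem_insert, not_or] at hk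
    exact hyk s k hk.1 hk.2.1
  · have hik : y s i = x i := by
      simp only [mem_insert, not_or] at hi
      exact hyk s i hi.1 hi.2.1
    rw [blossom_insert b hi, blossom_insert b hi, hU, hik, add_le_add_iff_left,
      blossom_insert_insert _ hne hjW hlW, blossom_insert_insert _ hne hjW hlW, hyW, hyW, hyW,
      hyj, hyl, ← hBdef, ← hCdef]
    have := mul_nonneg hD (sub_nonneg.2 hsum.le)
    have hxj : x j = p - β := by rw [hpdef]; ring
    have hxl : x l = q - β := by rw [hqdef]; ring
    rw [hxj, hxl]
    linear_combination this - B * hprod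
  · rw [sum_insert (by simp [hne, hjW]), sum_insert hlW, sum_insert (by simp [hne, hjW]),
      sum_insert hlW, hyj, hyl,
      sum_congr rfl fun k hk => hyk s k (ne_of_mem_of_not_mem hk hjW)
        (ne_of_mem_of_not_mem hk hlW)]
    linarith

/-- On the boundary part where `blossom b U` vanishes, `blossom b (insert i U)` is at most its value
at the diagonal point of that part. -/
theorem StableOn.blossom_insert_le [Fintype ι] {b : ℕ → ℝ} (hb : b 0 = 1) {U : Finset ι}
    (hU : U.Nonempty) (h : StableOn b U) {i : ι} (hi : i ∉ U) {z : ℝ} (hz : appell b #U z = 0)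
    (hzpos : ∀ x > z, ∀ m ≤ #U, 0 < appell b m x) {x : ι → ℝ} (hx : NonnegOn b U x)
    (hx0 : blossom b U x = 0) : blossom b (insert i U) x ≤ appell b (#U + 1) z := by
  by_contra! hlt
  obtain ⟨η, hη1, hη2⟩ := exists_between hlt
  -- `φ t` is the value of `blossom b (insert i U)` when all coordinates in `U` equal `t` and the
  -- `i`-th is `x i`; at the root `z` the second term vanishes.
  set φ : ℝ → ℝ := fun t => appell b (#U + 1) t + (x i - t) * appell b #U t with hφ
  have hφc : Continuous φ := by fun_prop
  have hφz : φ z < η := by simpa [hφ, hz] using hη1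
  obtain ⟨x₀, hx₀, hφ₀⟩ : ∃ x₀ > z, ∀ t, z < t → t < x₀ → φ t < η := by
    obtain ⟨u, hu, hsub⟩ := mem_nhdsGT_iff_exists_Ioo_subset.1
      (nhdsWithin_le_nhds (hφc.continuousAt.eventually (eventually_lt_nhds hφz)) :
        {t | φ t < η} ∈ 𝓝[>] z)
    exact ⟨u, hu, fun t h1 h2 => hsub ⟨h1, h2⟩⟩
  -- Raising the coordinates in `U` by a small `ε` moves `x` off the zero set into `PosOn b U`,
  -- where symmetrization applies.
  set v : ℝ → ι → ℝ := fun ε k => if k ∈ U then ε else 0 with hv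
  have hxvc : Continuous fun ε => x + v ε := by
    refine continuous_const.add (continuous_pi fun k => ?_)
    by_cases hk : k ∈ U
    · simpa [hv, hk] using continuous_id'
    · simpa [hv, hk] using continuous_const
  have hxv0 : x + v 0 = x := by ext k; simp [hv]
  obtain ⟨ε, hε1, hε2, hε⟩ : ∃ ε, η < blossom b (insert i U) (x + v ε) ∧
      blossom b U (x + v ε) < appell b #U x₀ ∧ 0 < ε := by
    have e1 : ∀ᶠ ε in 𝓝[>] (0 : ℝ), η < blossom b (insert i U) (x + v ε) :=
      nhdsWithin_le_nhds (((continuous_blossom b (insert i U)).comp hxvc).continuousAt.eventually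
        (eventually_gt_nhds (by simpa [hxv0] using hη2)))
    have e2 : ∀ᶠ ε in 𝓝[>] (0 : ℝ), blossom b U (x + v ε) < appell b #U x₀ :=
      nhdsWithin_le_nhds (((continuous_blossom b U).comp hxvc).continuousAt.eventually
        (eventually_lt_nhds (by simpa [hxv0, hx0] using hzpos x₀ hx₀ _ le_rfl)))
    exact (e1.and (e2.and self_mem_nhdsWithin)).exists
  have hpos0 : PosOn b U (x + v ε) := hx.posOn_add hb fun k hk => by simpa [hv, hk] using hε
  set x₁ := x + v ε with hx₁
  have hδ := hpos0 U subset_rfl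
  -- The constraints survive symmetrization, so a minimizer of the sum over `K` must be diagonal on
  -- `U`.
  set K : Set (ι → ℝ) := {y | (∀ k ∉ U, y k = x₁ k) ∧ NonnegOn b U y ∧
    blossom b U y = blossom b U x₁ ∧ η ≤ blossom b (insert i U) y ∧
    ∑ k ∈ U, y k ≤ ∑ k ∈ U, x₁ k} with hK
  have hKclosed : IsClosed K := by
    simp only [hK, Set.ofPred_and]
    refine IsClosed.inter ?_ <| (isClosed_nonnegOn b U).inter <| IsClosed.inter ?_ <|
      IsClosed.inter ?_ ?_
    · simp only [Set.ofPred_forall]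
      exact isClosed_iInter fun k => isClosed_iInter fun _ =>
        isClosed_eq (continuous_apply k) continuous_const
    · exact isClosed_eq (continuous_blossom b U) continuous_const
    · exact isClosed_le continuous_const (continuous_blossom b _)
    · exact isClosed_le (by fun_prop) continuous_const
  -- The derivatives on singletons, `y k + b 1`, bound the coordinates from below; with the bounded
  -- sum this makes `K` compact.
  have hlow {y : ι → ℝ} (hy : NonnegOn b U y) {k : ι} (hk : k ∈ U) : -b 1 ≤ y k := by
    have := hy {k} (by simpa using hk)
    rw [blossom_singleton, hb] at this
    linarith
  have hKcomp : IsCompact K := by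
    refine (isCompact_Icc (a := fun k => if k ∈ U then -b 1 else x₁ k)
      (b := fun k => if k ∈ U then -b 1 + ∑ k ∈ U, (x₁ k + b 1) else x₁ k)).of_isClosed_subset
      hKclosed ?_
    rintro y ⟨h1, h2, -, -, h5⟩
    constructor
    · intro k
      by_cases hk : k ∈ U
      · simpa [hk] using hlow h2 hk
      · simp [hk, h1 k hk]
    · intro k
      by_cases hk : k ∈ U
      · have h6 := single_le_sum (f := fun k => y k + b 1) (s := U)
          (fun j hj => by linarith [hlow h2 hj]) hk
        simp only [sum_add_distrib] at h6
        simp only [hk, if_true, sum_add_distrib]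
        linarith
      · simp [hk, h1 k hk]
  obtain ⟨y, hyK, hymin⟩ := hKcomp.exists_isMinOn
    ⟨x₁, fun _ _ => rfl, hpos0.nonnegOn, rfl, hε1.le, le_rfl⟩
    (f := fun y => ∑ k ∈ U, y k) (by fun_prop)
  obtain ⟨h1, h2, h3, h4, h5⟩ := hyK
  have hypos : PosOn b U y := h y h2 (h3 ▸ hδ)
  have hnlt : ∀ j ∈ U, ∀ l ∈ U, ¬ y j < y l := by
    intro j hj l hl hjl
    obtain ⟨w, w1, w2, w3, w4, w5⟩ := h.exists_sum_lt hypos hi hj hl hjl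
    have := hymin (show w ∈ K from ⟨fun k hk => (w1 k hk).trans (h1 k hk), w2.nonnegOn,
      w3.trans h3, h4.trans w4, w5.le.trans h5⟩)
    exact absurd w5 (not_lt.2 this)
  obtain ⟨j, hj⟩ := hU
  have hdiag : ∀ k ∈ U, y k = y j := fun k hk =>
    le_antisymm (not_lt.1 (hnlt j hj k hk)) (not_lt.1 (hnlt k hk j hj))
  set t := y j with ht
  have hTt {T : Finset ι} (hT : T ⊆ U) (b' : ℕ → ℝ) : blossom b' T y = appell b' #T t := by
    rw [← blossom_const]
    exact blossom_congr _ fun k hk => hdiag k (hT hk)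
  have htpos : ∀ m ≤ #U, 0 < appell b m t := by
    intro m hm
    obtain ⟨T, hT, rfl⟩ := exists_subset_card_eq hm
    exact hTt hT b ▸ hypos T hT
  have hzt : z < t := by
    by_contra! hle
    have := appell_mono hb (fun m hm => (htpos m hm).le) hle
    linarith [htpos _ le_rfl]
  have htx : t < x₀ := by
    by_contra! hle
    have e := appell_mono hb (fun m hm => (hzpos x₀ hx₀ m hm).le) hle
    rw [← hTt subset_rfl b, h3] at e
    linarith
  have hyi : y i = x i := by rw [h1 i hi]; simp [hx₁, hv, hi]
  have hval : blossom b (insert i U) y = φ t := by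
    have e := blossom_insert b hi (fun _ => t)
    rw [blossom_const, blossom_const, blossom_const, card_insert_of_notMem hi] at e
    rw [blossom_insert b hi, hTt subset_rfl, hTt subset_rfl, hyi, hφ]
    simp only [e]
    ring
  exact absurd (hφ₀ t hzt htx) (not_lt.2 (hval ▸ h4))

/-! ### From ordered roots on the diagonal to stability. -/

/-- The right-Noetherian condition in terms of the Appell sequence of derivatives. -/
def AppellNoetherian (b : ℕ → ℝ) (n : ℕ) : Prop :=
  ∀ m < n, ∃ x, appell b (m + 1) x = 0 ∧ ∀ y, appell b m y = 0 → y ≤ x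

theorem appell_nonneg_of_forall_gt {b : ℕ → ℝ} {m : ℕ} {x : ℝ}
    (h : ∀ y > x, 0 < appell b m y) : 0 ≤ appell b m x :=
  ge_of_tendsto ((continuous_appell b m).continuousWithinAt (s := Set.Ioi x))
    (eventually_mem_nhdsWithin.mono fun y hy => (h y hy).le)

/-- The chosen roots increase with the degree, so at `x` all lower members of the sequence are
nonnegative, and the Taylor bound makes them positive to the right. -/
theorem AppellNoetherian.pos_of_gt {b : ℕ → ℝ} (hb : b 0 = 1) {n : ℕ}
    (h : AppellNoetherian b n) {m : ℕ} (hm : m < n) {x : ℝ} (hx : appell b (m + 1) x = 0)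
    (hxm : ∀ y, appell b m y = 0 → y ≤ x) : ∀ y > x, ∀ j ≤ m + 1, 0 < appell b j y := by
  induction m generalizing x with
  | zero =>
    intro y hy j hj
    refine appell_pos_of_lt hb (fun k hk => ?_) hy
    obtain rfl | rfl : k = 0 ∨ k = 1 := by lia
    · simp [appell_zero, hb]
    · exact hx.ge
  | succ m ih =>
    obtain ⟨z, hz, hzm⟩ := h m (by lia)
    have hzx := hxm z hz
    have hpos := ih (by lia) hz hzm
    intro y hy j hj
    rcases hj.lt_or_eq with hj | rfl
    · exact hpos y (hzx.trans_lt hy) j (by lia)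
    · refine appell_pos_of_lt hb (fun k hk => ?_) hy
      rcases hk.lt_or_eq with hk | rfl
      · exact appell_nonneg_of_forall_gt fun w hw => hpos w (hzx.trans_lt hw) k (by lia)
      · exact hx.ge

/-- The largest root of `appell b (m + 1)`, beyond which all the lower ones are positive. -/
theorem AppellNoetherian.exists_root {b : ℕ → ℝ} (hb : b 0 = 1) {n : ℕ}
    (h : AppellNoetherian b n) {m : ℕ} (hm : m < n) :
    ∃ z, appell b (m + 1) z = 0 ∧ (∀ x > z, ∀ j ≤ m + 1, 0 < appell b j x) ∧
      ∀ j ≤ m + 1, 0 ≤ appell b j z := by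
  obtain ⟨z, hz, hzm⟩ := h m hm
  have := h.pos_of_gt hb hm hz hzm
  exact ⟨z, hz, this, fun j hj => appell_nonneg_of_forall_gt fun y hy => this y hy j hj⟩

theorem StableOn.posOn_of_erase {b : ℕ → ℝ} {U : Finset ι} (h : ∀ i ∈ U, StableOn b (U.erase i))
    {x : ι → ℝ} (hx : NonnegOn b U x) (hpos : ∀ i ∈ U, 0 < blossom b (U.erase i) x) :
    ∀ T ⊂ U, 0 < blossom b T x := by
  intro T hT
  obtain ⟨i, hiU, hiT⟩ := exists_of_ssubset hT
  exact h i hiU x (hx.mono (erase_subset _ _)) (hpos i hiU) T (subset_erase.2 ⟨hT.subset, hiT⟩)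

/-- By induction on `U` it suffices that no first derivative vanishes at `x`. If one does, the
diagonal bound makes `appell b #U` positive at the largest root `z` of its predecessor, hence, by
monotonicity, at the root `w ≥ z` as well. -/
theorem AppellNoetherian.stableOn [Fintype ι] {b : ℕ → ℝ} (hb : b 0 = 1) {n : ℕ}
    (h : AppellNoetherian b n) (U : Finset ι) (hU : #U ≤ n) : StableOn b U := by
  induction U using Finset.strongInduction with
  | H U ih =>
  intro x hx hpos
  have ih' : ∀ i ∈ U, StableOn b (U.erase i) := fun i hi =>
    ih _ (erase_ssubset hi) ((card_le_card (erase_subset _ _)).trans hU)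
  have key : ∀ i ∈ U, 0 < blossom b (U.erase i) x := by
    intro i hi
    refine (hx _ (erase_subset _ _)).lt_of_ne' fun h0 => ?_
    rcases (U.erase i).eq_empty_or_nonempty with he | hne
    · rw [he, blossom_empty, hb] at h0
      exact one_ne_zero h0
    · obtain ⟨m, hm⟩ : ∃ m, #(U.erase i) = m + 1 :=
        Nat.exists_eq_succ_of_ne_zero (card_pos.2 hne).ne'
      have hcard : #(U.erase i) + 1 = #U := card_erase_add_one hi
      obtain ⟨z, hz, hzpos, hznn⟩ := h.exists_root hb (m := m) (by lia)
      rw [← hm] at hz hzpos hznn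
      have hle := (ih' i hi).blossom_insert_le hb hne (notMem_erase i U) hz hzpos
        (hx.mono (erase_subset _ _)) h0
      rw [insert_erase hi] at hle
      obtain ⟨w, hw, hwm⟩ := h #(U.erase i) (by lia)
      have := appell_mono hb (m := #(U.erase i) + 1) (x := z) (y := w) (fun j hj => ?_) (hwm z hz)
      · linarith
      · rcases hj.lt_or_eq with hj | rfl
        · exact hznn j (by lia)
        · linarith
  intro T hT
  rcases hT.ssubset_or_eq with hT | rfl
  · exact StableOn.posOn_of_erase ih' hx key T hT
  · exact hpos

/-! ### From stability to ordered roots on the diagonal. -/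

/-- A point of `PosOn b U` lifts to `PosOn b (insert i U)` by a large `i`-th coordinate. -/
theorem PosOn.eventually_update {b : ℕ → ℝ} {U : Finset ι} {x : ι → ℝ} (h : PosOn b U x) (i : ι) :
    ∀ᶠ L in atTop, PosOn b (insert i U) (Function.update x i L) := by
  have key : ∀ T ∈ U.powerset, ∀ᶠ L in atTop,
      0 < L * blossom b T x + blossom (fun k => b (k + 1)) T x := fun T hT =>
    (tendsto_atTop_add_const_right _ _
      (tendsto_id.atTop_mul_const (h T (mem_powerset.1 hT)))).eventually_gt_atTop 0
  filter_upwards [(eventually_all_finset _).2 key] with L hL T hT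
  by_cases hiT : i ∈ T
  · have hTe : T.erase i ⊆ U := subset_insert_iff.1 hT
    rw [← insert_erase hiT, blossom_insert_update b (notMem_erase i T)]
    exact hL _ (mem_powerset.2 hTe)
  · rw [blossom_update_of_notMem b hiT]
    exact h T ((subset_insert_iff_of_notMem hiT).1 hT)

/-- For a large `i`-th coordinate `L`, the term `L * blossom b U` dominates, so the path from `x +
1` down to `x` lifts to the positivity set of `insert i U`, where stability applies. -/
theorem StableOn.of_insert {b : ℕ → ℝ} (hb : b 0 = 1) {U : Finset ι} {i : ι} (hi : i ∉ U)
    (h : StableOn b (insert i U)) : StableOn b U := by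
  intro x hx hpos
  set γ : ℝ → ι → ℝ := fun t => x + fun _ => t with hγ
  have hγc : Continuous γ := by fun_prop
  have hγ0 : γ 0 = x := by ext; simp [hγ]
  have hge : ∀ t ∈ Set.Icc (0 : ℝ) 1, blossom b U x ≤ blossom b U (γ t) := fun t ht =>
    hx.le_add hb fun _ _ => ht.1
  have h1 : PosOn b U (γ 1) := hx.posOn_add hb fun _ _ => one_pos
  -- `M` bounds the term free of the `i`-th variable along the path; `L` is then taken with `L *
  -- blossom b U x > M`.
  obtain ⟨M, hM⟩ := isCompact_Icc.exists_bound_of_continuousOn (s := Set.Icc (0 : ℝ) 1)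
    ((continuous_blossom (fun k => b (k + 1)) U).comp hγc).continuousOn
  obtain ⟨L, hL1, hLM, hL0⟩ := ((h1.eventually_update i).and
    (((tendsto_id.atTop_mul_const hpos).eventually_gt_atTop M).and (eventually_ge_atTop 0))).exists
  have hS : IsPreconnected ((fun t => Function.update (γ t) i L) '' Set.Icc (0 : ℝ) 1) :=
    isPreconnected_Icc.image _ (by fun_prop)
  have key := h.subset_of_isPreconnected hS (x := Function.update (γ 1) i L) ?_
    ⟨1, by simp, rfl⟩ hL1 (Function.update x i L) ⟨0, by simp, by simp [hγ0]⟩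
  · intro T hT
    rw [← blossom_update_of_notMem b (fun hiT => hi (hT hiT)) x L]
    exact key T (hT.trans (subset_insert _ _))
  · rintro _ ⟨t, ht, rfl⟩
    dsimp only
    rw [blossom_insert_update b hi]
    have e1 := mul_le_mul_of_nonneg_left (hge t ht) hL0
    have e2 := (abs_le.1 (hM t ht)).1
    simp only [Function.comp_apply, id] at e2 hLM
    linarith

theorem StableOn.mono {b : ℕ → ℝ} (hb : b 0 = 1) {U V : Finset ι} (hUV : U ⊆ V)
    (h : StableOn b V) : StableOn b U := by
  induction hn : #(V \ U) generalizing U with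
  | zero =>
    rw [card_eq_zero, sdiff_eq_empty_iff_subset] at hn
    rwa [hUV.antisymm hn]
  | succ m ih =>
    obtain ⟨i, hi⟩ := card_pos.1 (hn.symm ▸ m.succ_pos : 0 < #(V \ U))
    obtain ⟨hiV, hiU⟩ := mem_sdiff.1 hi
    refine StableOn.of_insert hb hiU (ih (insert_subset hiV hUV) ?_)
    rw [sdiff_insert, card_erase_of_mem hi, hn, Nat.add_sub_cancel]

theorem posOn_const_iff {b : ℕ → ℝ} {U : Finset ι} {x : ℝ} :
    PosOn b U (fun _ => x) ↔ ∀ m ≤ #U, 0 < appell b m x := by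
  refine ⟨fun h m hm => ?_, fun h T hT => ?_⟩
  · obtain ⟨T, hT, rfl⟩ := exists_subset_card_eq hm
    exact blossom_const b T x ▸ h T hT
  · rw [blossom_const]
    exact h _ (card_le_card hT)

theorem nonnegOn_const_iff {b : ℕ → ℝ} {U : Finset ι} {x : ℝ} :
    NonnegOn b U (fun _ => x) ↔ ∀ m ≤ #U, 0 ≤ appell b m x := by
  refine ⟨fun h m hm => ?_, fun h T hT => ?_⟩
  · obtain ⟨T, hT, rfl⟩ := exists_subset_card_eq hm
    exact blossom_const b T x ▸ h T hT
  · rw [blossom_const]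
    exact h _ (card_le_card hT)

/-- The root is the left endpoint of the diagonal positivity region. Were the top member positive
there, stability would put the endpoint in the open set `PosOn b U`, and the region would extend
further left. -/
theorem StableOn.exists_root {b : ℕ → ℝ} (hb : b 0 = 1) {U : Finset ι} (h : StableOn b U) {m : ℕ}
    (hm : #U = m + 1) : ∃ x, appell b (m + 1) x = 0 ∧ ∀ y, appell b m y = 0 → y ≤ x := by
  set Z : Set ℝ := {x | ∀ j ≤ m + 1, 0 < appell b j x} with hZ
  have hZne : Z.Nonempty := exists_appell_pos hb (m + 1)
  have hZbdd : BddBelow Z := ⟨-b 1, fun x hx => by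
    have := hx 1 (by lia)
    rw [appell_one, hb] at this
    linarith⟩
  have hZup : ∀ x > sInf Z, x ∈ Z := by
    intro x hx j hj
    obtain ⟨y, hy, hyx⟩ := exists_lt_of_csInf_lt hZne hx
    exact appell_pos_of_lt hb (fun k hk => (hy k (hk.trans hj)).le) hyx
  have hnn : ∀ j ≤ m + 1, 0 ≤ appell b j (sInf Z) := fun j hj =>
    appell_nonneg_of_forall_gt fun y hy => hZup y hy j hj
  refine ⟨sInf Z, ?_, fun y hy => ?_⟩
  · refine le_antisymm (not_lt.1 fun hpos => ?_) (hnn _ le_rfl)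
    have hmem : PosOn b U (fun _ => sInf Z) :=
      h _ (nonnegOn_const_iff.2 (hm ▸ hnn)) (by rwa [blossom_const, hm])
    have hopen : IsOpen {t : ℝ | PosOn b U fun _ => t} :=
      (isOpen_posOn b U).preimage (by fun_prop)
    obtain ⟨ε, hε, hball⟩ := Metric.isOpen_iff.1 hopen _ hmem
    have hlt : PosOn b U (fun _ => sInf Z - ε / 2) :=
      hball (by simp [abs_of_pos hε, hε])
    rw [posOn_const_iff, hm] at hlt
    have : sInf Z ≤ sInf Z - ε / 2 := csInf_le hZbdd hlt
    linarith
  · by_contra! hlt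
    exact (hZup y hlt m m.le_succ).ne' hy

theorem StableOn.appellNoetherian [Fintype ι] {b : ℕ → ℝ} (hb : b 0 = 1)
    (h : StableOn b (univ : Finset ι)) : AppellNoetherian b (Fintype.card ι) := by
  intro m hm
  obtain ⟨T, hT, hTm⟩ := exists_subset_card_eq (s := (univ : Finset ι)) (n := m + 1) hm
  exact (h.mono hb hT).exists_root hb hTm

/-! ### Translation to `poly` and to univariate derivatives. -/

/-- The coefficients of `poly n c`, indexed by codegree. -/
noncomputable def codegCoeff {n : ℕ} (c : Fin n → ℝ) (j : ℕ) : ℝ :=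
  -- The default `1` is the leading coefficient at `j = 0`; indices above `n` never enter `blossom`
  -- over subsets of `Fin n`.
  if h : 0 < j ∧ j ≤ n then -c ⟨n - j, by lia⟩ else 1

theorem codegCoeff_zero {n : ℕ} (c : Fin n → ℝ) : codegCoeff c 0 = 1 := by simp [codegCoeff]

theorem codegCoeff_sub {n : ℕ} (c : Fin n → ℝ) (k : Fin n) : codegCoeff c (n - k) = -c k := by
  have hk := k.2
  rw [codegCoeff, dif_pos (by lia)]
  congr 2
  exact Fin.ext (by simp only; lia)

theorem eval_poly {n : ℕ} (c : Fin n → ℝ) (x : Fin n → ℝ) :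
    MvPolynomial.eval x (poly n c) = blossom (codegCoeff c) univ x := by
  have h1 : blossom (codegCoeff c) univ x = ∑ k ∈ range (n + 1), codegCoeff c (n - k) *
      ∑ T ∈ powersetCard k univ, ∏ i ∈ T, x i := by
    rw [blossom, sum_powerset]
    simp only [card_univ, Fintype.card_fin, mul_sum]
    refine sum_congr rfl fun k _ => sum_congr rfl fun T hT => ?_
    rw [(mem_powersetCard.1 hT).2]
  rw [h1, sum_range_succ, sum_range (n := n)]
  have h2 : powersetCard n (univ : Finset (Fin n)) = {univ} := by
    simpa using powersetCard_self (univ : Finset (Fin n))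
  simp only [codegCoeff_sub, h2, Nat.sub_self, codegCoeff_zero, sum_singleton, poly, map_sub,
    map_prod, map_sum, map_mul, MvPolynomial.eval_X, MvPolynomial.eval_C, MvPolynomial.esymm,
    neg_mul, sum_neg_distrib]
  ring

/-- `appell` as a polynomial. -/
noncomputable def appellPoly (b : ℕ → ℝ) (m : ℕ) : Polynomial ℝ :=
  ∑ k ∈ range (m + 1), Polynomial.C ((m.choose k : ℝ) * b (m - k)) * Polynomial.X ^ k

theorem eval_appellPoly (b : ℕ → ℝ) (m : ℕ) (x : ℝ) :
    (appellPoly b m).eval x = appell b m x := by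
  simp [appellPoly, appell, Polynomial.eval_finsetSum, mul_assoc]

theorem coeff_appellPoly (b : ℕ → ℝ) (m k : ℕ) :
    (appellPoly b m).coeff k = (m.choose k : ℝ) * b (m - k) := by
  simp only [appellPoly, Polynomial.finsetSum_coeff, Polynomial.coeff_C_mul_X_pow]
  rw [sum_ite_eq]
  split_ifs with h
  · rfl
  · rw [Nat.choose_eq_zero_of_lt (by simpa [Nat.succ_le_iff] using h)]
    simp

theorem natDegree_appellPoly {b : ℕ → ℝ} (hb : b 0 = 1) (m : ℕ) :
    (appellPoly b m).natDegree = m := by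
  refine Polynomial.natDegree_eq_of_le_of_coeff_ne_zero ?_ (by simp [coeff_appellPoly, hb])
  refine Polynomial.natDegree_le_iff_coeff_eq_zero.2 fun k hk => ?_
  simp [coeff_appellPoly, Nat.choose_eq_zero_of_lt hk]

theorem derivative_appellPoly (b : ℕ → ℝ) (m : ℕ) :
    Polynomial.derivative (appellPoly b (m + 1))
      = Polynomial.C ((m + 1 : ℕ) : ℝ) * appellPoly b m := by
  ext k
  rw [Polynomial.coeff_derivative, Polynomial.coeff_C_mul, coeff_appellPoly, coeff_appellPoly,
    Nat.add_sub_add_right, mul_right_comm, ← mul_assoc]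
  have : ((m + 1).choose (k + 1) : ℝ) * (k + 1) = (m + 1 : ℕ) * m.choose k := by
    exact_mod_cast (Nat.add_one_mul_choose_eq m k).symm
  rw [this]

theorem iterate_derivative_appellPoly (b : ℕ → ℝ) (k m : ℕ) :
    ∃ a : ℝ, a ≠ 0 ∧ Polynomial.derivative^[k] (appellPoly b (m + k))
      = Polynomial.C a * appellPoly b m := by
  induction k with
  | zero => exact ⟨1, one_ne_zero, by simp⟩
  | succ k ih =>
    obtain ⟨a, ha, h⟩ := ih
    refine ⟨((m + k + 1 : ℕ) : ℝ) * a, mul_ne_zero (by positivity) ha, ?_⟩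
    rw [Function.iterate_succ_apply, ← add_assoc, derivative_appellPoly,
      Polynomial.iterate_derivative_C_mul, h, Polynomial.C_mul, mul_assoc]

theorem isRoot_iterate_derivative_appellPoly (b : ℕ → ℝ) (k m : ℕ) (x : ℝ) :
    (Polynomial.derivative^[k] (appellPoly b (m + k))).IsRoot x ↔ appell b m x = 0 := by
  obtain ⟨a, ha, h⟩ := iterate_derivative_appellPoly b k m
  rw [h, Polynomial.IsRoot.def, Polynomial.eval_mul, Polynomial.eval_C, eval_appellPoly]
  simp [ha]

theorem rightNoetherian_appellPoly {b : ℕ → ℝ} (hb : b 0 = 1) (n : ℕ) :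
    RightNoetherian (appellPoly b n) ↔ AppellNoetherian b n := by
  have key : ∀ k m, m + 1 + k = n →
      ((∃ x : ℝ, (Polynomial.derivative^[k] (appellPoly b n)).IsRoot x ∧
        ∀ y : ℝ, (Polynomial.derivative^[k + 1] (appellPoly b n)).IsRoot y → y ≤ x) ↔
      ∃ x, appell b (m + 1) x = 0 ∧ ∀ y, appell b m y = 0 → y ≤ x) := by
    rintro k m rfl
    simp only [isRoot_iterate_derivative_appellPoly]
    rw [show m + 1 + k = m + (k + 1) by ring]
    simp only [isRoot_iterate_derivative_appellPoly]
  rw [RightNoetherian, AppellNoetherian, natDegree_appellPoly hb]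
  exact ⟨fun h m hm => (key (n - (m + 1)) m (by lia)).1 (h _ (by lia)),
    fun h k hk => (key k (n - (k + 1)) (by lia)).2 (h _ (by lia))⟩

theorem strictlyRightNoetherian_appellPoly {b : ℕ → ℝ} (hb : b 0 = 1) (m : ℕ) :
    StrictlyRightNoetherian (appellPoly b (m + 1)) ↔ AppellNoetherian b (m + 1) ∧
      ∃ x, appell b (m + 1) x = 0 ∧ ∀ y, appell b m y = 0 → y < x := by
  have h0 := isRoot_iterate_derivative_appellPoly b 0 (m + 1)
  have h1 := isRoot_iterate_derivative_appellPoly b 1 m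
  simp only [Function.iterate_zero_apply, Function.iterate_one, add_zero] at h0 h1
  simp only [StrictlyRightNoetherian, rightNoetherian_appellPoly hb, h0, h1]

theorem diagRestriction_poly_eq {n : ℕ} (c : Fin n → ℝ) :
    diagRestriction (poly n c) = appellPoly (codegCoeff c) n := by
  rw [diagRestriction_poly, appellPoly, sum_range_succ, sum_range (n := n)]
  simp only [codegCoeff_sub, Nat.choose_self, Nat.sub_self, codegCoeff_zero, mul_neg, map_neg,
    neg_mul, sum_neg_distrib]
  simp only [Nat.cast_one, mul_one, map_one, one_mul, mul_comm (c _)]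
  ring

/-! ### Connected components -/

variable {n : ℕ}

/-- The set is closed under increasing coordinates, so two points are joined by segments to their
supremum. -/
theorem isPreconnected_posOn {b : ℕ → ℝ} (hb : b 0 = 1)
    (U : Finset ι) : IsPreconnected {x : ι → ℝ | PosOn b U x} := by
  have hseg : ∀ x w : ι → ℝ, PosOn b U x → x ≤ w → segment ℝ x w ⊆ {x | PosOn b U x} := by
    intro x w hx hxw y hy
    have hle : x ≤ y := (segment_subset_Icc hxw hy).1
    have := hx.add hb (v := y - x) fun i _ => sub_nonneg.2 (hle i)
    rwa [add_sub_cancel] at this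
  refine isPreconnected_of_forall_pair fun x hx y hy => ?_
  refine ⟨segment ℝ x (x ⊔ y) ∪ segment ℝ y (x ⊔ y), ?_, ?_, ?_, ?_⟩
  · exact Set.union_subset (hseg _ _ hx le_sup_left) (hseg _ _ hy le_sup_right)
  · exact Or.inl (left_mem_segment ℝ _ _)
  · exact Or.inr (left_mem_segment ℝ _ _)
  · exact IsPreconnected.union (x ⊔ y) (right_mem_segment ℝ _ _) (right_mem_segment ℝ _ _)
      (convex_segment _ _).isPreconnected (convex_segment _ _).isPreconnected

theorem upsilonStable_posOn {b : ℕ → ℝ} (hb : b 0 = 1) :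
    UpsilonStable {x : Fin n → ℝ | PosOn b univ x} := by
  refine ⟨fun _ => -b 1, fun x hx => ⟨fun i => x i + b 1, fun i => ?_, ?_⟩⟩
  · have := hx {i} (subset_univ _)
    rwa [blossom_singleton, hb, mul_one] at this
  · ext i; simp

theorem StableOn.isConnComponent {b : ℕ → ℝ} (hb : b 0 = 1)
    {U : Finset ι} (h : StableOn b U) :
    IsConnComponent {x : ι → ℝ | 0 < blossom b U x} {x | PosOn b U x} := by
  obtain ⟨t, ht⟩ := exists_appell_pos hb #U
  have hx : PosOn b U (fun _ => t) := posOn_const_iff.2 ht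
  have hxU := hx U subset_rfl
  refine ⟨_, hxU, Set.Subset.antisymm ?_ fun y hy => ?_⟩
  · exact (isPreconnected_posOn hb U).subset_connectedComponentIn hx
      fun y hy => hy U subset_rfl
  · exact h.subset_of_isPreconnected isPreconnected_connectedComponentIn
      (connectedComponentIn_subset {x | 0 < blossom b U x} _) (mem_connectedComponentIn hxU) hx y hy

section Component

variable {S G : Set (Fin n → ℝ)}

theorem IsConnComponent.subset (h : IsConnComponent S G) : G ⊆ S := by
  obtain ⟨x, -, rfl⟩ := h
  exact connectedComponentIn_subset _ _

theorem IsConnComponent.nonempty (h : IsConnComponent S G) : G.Nonempty := by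
  obtain ⟨x, hx, rfl⟩ := h
  exact ⟨x, mem_connectedComponentIn hx⟩

theorem IsConnComponent.subset_of_mem (h : IsConnComponent S G) {P : Set (Fin n → ℝ)}
    (hP : IsPreconnected P) (hPS : P ⊆ S) {y : Fin n → ℝ} (hyP : y ∈ P) (hyG : y ∈ G) :
    P ⊆ G := by
  obtain ⟨x, -, rfl⟩ := h
  rw [connectedComponentIn_eq hyG]
  exact hP.subset_connectedComponentIn hyP hPS

theorem IsConnComponent.isOpen (hS : IsOpen S) (h : IsConnComponent S G) : IsOpen G := by
  obtain ⟨x, -, rfl⟩ := h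
  exact hS.connectedComponentIn

end Component

theorem blossom_univ_update (b : ℕ → ℝ) (x : Fin n → ℝ) (i : Fin n) (t : ℝ) :
    blossom b univ (Function.update x i t)
      = blossom b univ x + (t - x i) * blossom b (univ.erase i) x := by
  have h := blossom_insert_update b (notMem_erase i univ) x t
  have h' := blossom_insert b (notMem_erase i univ) x
  rw [insert_erase (mem_univ i)] at h h'
  rw [h, h']
  ring

variable {b : ℕ → ℝ} {G : Set (Fin n → ℝ)}

/-- With a nonpositive slope in `x i`, the whole ray of decreasing `x i` would stay in `G`, which
has a lower bound `q i`. -/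
theorem IsConnComponent.blossom_erase_pos
    (hG : IsConnComponent {x : Fin n → ℝ | 0 < blossom b univ x} G) (hst : UpsilonStable G)
    {x : Fin n → ℝ} (hx : x ∈ G) (i : Fin n) : 0 < blossom b (univ.erase i) x := by
  by_contra! hle
  obtain ⟨q, hq⟩ := hst
  have hsub := hG.subset_of_mem (P := (fun t => Function.update x i t) '' Set.Iic (x i))
    (isPreconnected_Iic.image _ (by fun_prop)) ?_
    ⟨x i, Set.self_mem_Iic, Function.update_eq_self _ _⟩ hx
  · have hmem : Function.update x i (min (x i) (q i)) ∈ G := hsub ⟨_, Set.mem_Iic.2 (min_le_left _ _), rfl⟩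
    obtain ⟨v, hv, hvx⟩ := hq hmem
    have h1 := congrFun hvx i
    simp only [Pi.add_apply, Function.update_self] at h1
    linarith [hv i, min_le_right (x i) (q i)]
  · rintro _ ⟨t, ht, rfl⟩
    have h0 : 0 < blossom b univ x := hG.subset hx
    have h1 := mul_nonneg_of_nonpos_of_nonpos (sub_nonpos.2 (Set.mem_Iic.1 ht)) hle
    simp only [Set.mem_ofPred_eq, blossom_univ_update]
    linarith

theorem IsConnComponent.update_mem
    (hG : IsConnComponent {x : Fin n → ℝ | 0 < blossom b univ x} G) (hst : UpsilonStable G)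
    {x : Fin n → ℝ} (hx : x ∈ G) (i : Fin n) {t : ℝ} (ht : x i ≤ t) :
    Function.update x i t ∈ G := by
  have hpos := hG.blossom_erase_pos hst hx i
  refine hG.subset_of_mem (P := (fun t => Function.update x i t) '' Set.Ici (x i))
    (isPreconnected_Ici.image _ (by fun_prop)) ?_
    ⟨x i, Set.self_mem_Ici, Function.update_eq_self _ _⟩ hx ⟨t, ht, rfl⟩
  rintro _ ⟨t, ht, rfl⟩
  have h0 : 0 < blossom b univ x := hG.subset hx
  have h1 := mul_nonneg (sub_nonneg.2 (Set.mem_Ici.1 ht)) hpos.le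
  simp only [Set.mem_ofPred_eq, blossom_univ_update]
  linarith

/-- Induction on the number of derivatives taken: `G` is stable under increasing a coordinate, and
an affine function that is nonnegative for all large `t` has nonnegative slope. -/
theorem IsConnComponent.nonnegOn
    (hG : IsConnComponent {x : Fin n → ℝ | 0 < blossom b univ x} G) (hst : UpsilonStable G)
    {x : Fin n → ℝ} (hx : x ∈ G) : NonnegOn b univ x := by
  suffices H : ∀ k, ∀ T : Finset (Fin n), #Tᶜ = k → ∀ x ∈ G, 0 ≤ blossom b T x from
    fun T _ => H _ T rfl x hx
  intro k
  induction k with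
  | zero =>
    intro T hT x hx
    rw [card_eq_zero, compl_eq_empty_iff] at hT
    subst hT
    exact (hG.subset hx : 0 < blossom b univ x).le
  | succ k ih =>
    intro T hT x hx
    obtain ⟨i, hi⟩ := card_pos.1 (hT.symm ▸ k.succ_pos : 0 < #Tᶜ)
    have hiT : i ∉ T := mem_compl.1 hi
    by_contra! hneg
    have hins : ∀ t ≥ x i, 0 ≤ t * blossom b T x + blossom (fun k => b (k + 1)) T x := by
      intro t ht
      rw [← blossom_insert_update b hiT]
      refine ih _ ?_ _ (hG.update_mem hst hx i ht)
      rw [compl_insert, card_erase_of_mem hi, hT, Nat.add_sub_cancel]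
    have htend := tendsto_atBot_add_const_right atTop (blossom (fun k => b (k + 1)) T x)
      (tendsto_id.atTop_mul_const_of_neg hneg)
    obtain ⟨t, ht, htx⟩ := ((htend.eventually_lt_atBot 0).and (eventually_ge_atTop (x i))).exists
    exact absurd (hins t htx) (not_le.2 ht)

/-- The only candidate for an `Υ`-stable component is the set where all derivatives are positive. -/
theorem IsConnComponent.eq_posOn (hb : b 0 = 1)
    (hG : IsConnComponent {x : Fin n → ℝ | 0 < blossom b univ x} G) (hst : UpsilonStable G) :
    G = {x | PosOn b univ x} := by
  have hsub : G ⊆ {x | PosOn b univ x} := by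
    intro x hx
    have hopen : IsOpen G := hG.isOpen (isOpen_lt continuous_const (continuous_blossom b univ))
    -- `G` is open, so `x - ε` lies in it; moving back by `ε` turns nonnegative derivatives into
    -- positive ones.
    have hev : ∀ᶠ ε in 𝓝[>] (0 : ℝ), (x - fun _ => ε) ∈ G := by
      have hc : Continuous fun ε : ℝ => (x - fun _ => ε) := by fun_prop
      refine nhdsWithin_le_nhds (hc.continuousAt.eventually (hopen.mem_nhds ?_))
      convert hx using 1
      ext; simp
    obtain ⟨ε, hε, hε0⟩ := (hev.and self_mem_nhdsWithin).exists
    have := (hG.nonnegOn hst hε).posOn_add hb (v := fun _ => ε) fun _ _ => hε0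
    rwa [sub_add_cancel] at this
  refine hsub.antisymm ?_
  obtain ⟨x, hx⟩ := hG.nonempty
  exact hG.subset_of_mem (isPreconnected_posOn hb univ) (fun y hy => hy univ subset_rfl)
    (hsub hx) hx

theorem IsConnComponent.stableOn (hb : b 0 = 1)
    (hG : IsConnComponent {x : Fin n → ℝ | 0 < blossom b univ x} G) (hst : UpsilonStable G) :
    StableOn b (univ : Finset (Fin n)) := by
  intro x hx hpos
  have h1 : PosOn b univ (x + fun _ => 1) := hx.posOn_add hb fun _ _ => one_pos
  have heq := hG.eq_posOn hb hst
  have hsub := hG.subset_of_mem (P := segment ℝ x (x + fun _ => 1))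
    (convex_segment _ _).isPreconnected ?_ (right_mem_segment ℝ _ _) (heq ▸ h1)
  · have := hsub (left_mem_segment ℝ _ _)
    rwa [heq] at this
  · intro y hy
    have hle : x ≤ y := (segment_subset_Icc (fun i => by simp) hy).1
    have := hx.le_add hb (v := y - x) fun i _ => sub_nonneg.2 (hle i)
    rw [add_sub_cancel] at this
    exact hpos.trans_le this

/-! ### Strict stability -/

theorem dropLast_eq_iff {m : ℕ} {x y : Fin (m + 1) → ℝ} :
    dropLast 1 x = dropLast 1 y ↔ ∀ i ≠ Fin.last m, x i = y i := by
  constructor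
  · intro h i hi
    have hlt : (i : ℕ) < m := Fin.val_lt_last hi
    exact congrFun h (⟨i, hlt⟩ : Fin (m + 1 - 1))
  · intro h
    ext i
    refine h _ fun e => ?_
    have h1 := congrArg Fin.val e
    have h2 := i.2
    simp at h1
    lia

/-- A point of `PosOn` over all variables but one lifts by a large missing coordinate, so dropping
that coordinate projects exactly onto this set. Symmetry of `blossom` handles the permutations. -/
theorem mem_upsilonCone_posOn_iff {m : ℕ} {x : Fin (m + 1) → ℝ} :
    x ∈ upsilonCone 1 {x : Fin (m + 1) → ℝ | PosOn b univ x} ↔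
      ∀ i, PosOn b (univ.erase i) x := by
  constructor
  · intro h i T hT
    set s := Equiv.swap i (Fin.last m) with hs
    obtain ⟨w, hw, hwx⟩ := h s
    rw [dropLast_eq_iff] at hwx
    have h1 := blossom_map b s.toEmbedding (T.map s.symm.toEmbedding) x
    rw [Finset.map_map] at h1
    have e : s.symm.toEmbedding.trans s.toEmbedding = Function.Embedding.refl _ := by
      ext; simp
    rw [e, map_refl] at h1
    rw [h1, ← blossom_congr b (x := w)]
    · exact hw _ (subset_univ _)
    · intro j hj
      refine hwx j fun hjl => ?_
      obtain ⟨l, hl, hlj⟩ := mem_map.1 hj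
      have : l = i := by
        have h2 : s.symm l = Fin.last m := by simpa [hjl] using hlj
        rw [Equiv.symm_apply_eq] at h2
        simpa [hs] using h2
      exact (mem_erase.1 (hT hl)).1 this
  · intro h s
    have hpos : PosOn b (univ.erase (Fin.last m)) (fun i => x (s i)) := by
      intro T hT
      have h1 := blossom_map b s.toEmbedding T x
      have h2 : T.map s.toEmbedding ⊆ univ.erase (s (Fin.last m)) := by
        intro j hj
        obtain ⟨l, hl, rfl⟩ := mem_map.1 hj
        simpa using (mem_erase.1 (hT hl)).1
      exact h1 ▸ h _ _ h2
    obtain ⟨L, hL⟩ := (hpos.eventually_update (Fin.last m)).exists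
    rw [insert_erase (mem_univ _)] at hL
    exact ⟨_, hL, dropLast_eq_iff.2 fun i hi => Function.update_of_ne hi _ _⟩

/-- The diagonal frontier point forces the strict inequality of roots. Conversely, a first
derivative vanishing on the frontier would, by the diagonal bound, make `appell b (m + 1)`
nonnegative at the largest root of `appell b m`, hence positive at the strictly larger `w`, which is
a root. -/
theorem StableOn.frontier_subset_upsilonCone_iff {m : ℕ} (hb : b 0 = 1)
    (h : StableOn b (univ : Finset (Fin (m + 1)))) :
    frontier {x : Fin (m + 1) → ℝ | PosOn b univ x}
        ⊆ upsilonCone 1 {x : Fin (m + 1) → ℝ | PosOn b univ x} ↔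
      ∃ x, appell b (m + 1) x = 0 ∧ ∀ y, appell b m y = 0 → y < x := by
  have hN : AppellNoetherian b (m + 1) := by simpa using h.appellNoetherian hb
  rw [(isOpen_posOn b univ).frontier_eq]
  constructor
  · intro hsub
    obtain ⟨z, hz, hzm⟩ := hN m m.lt_succ_self
    have hgt := hN.pos_of_gt hb m.lt_succ_self hz hzm
    have hcl : (fun _ => z : Fin (m + 1) → ℝ) ∈ closure {x | PosOn b univ x} := by
      have hc : Continuous fun t : ℝ => (fun _ => t : Fin (m + 1) → ℝ) := by fun_prop
      refine mem_closure_of_tendsto (hc.continuousWithinAt (s := Set.Ioi z) (x := z))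
        (eventually_mem_nhdsWithin.mono fun t ht => posOn_const_iff.2 ?_)
      simpa using hgt t ht
    have hnot : ¬ PosOn b univ (fun _ => z : Fin (m + 1) → ℝ) := fun hp => by
      have := posOn_const_iff.1 hp (m + 1) (by simp)
      exact this.ne' hz
    have hmem := mem_upsilonCone_posOn_iff.1 (hsub ⟨hcl, hnot⟩) 0
    have hzpos := posOn_const_iff.1 hmem m (by simp)
    exact ⟨z, hz, fun y hy => (hzm y hy).lt_of_ne fun e => hzpos.ne' (e ▸ hy)⟩
  · rintro ⟨w, hw, hwm⟩ x ⟨hxcl, hxn⟩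
    have hx : NonnegOn b univ x := closure_posOn_subset b univ hxcl
    rw [mem_upsilonCone_posOn_iff]
    intro i
    have hst := h.mono hb (erase_subset i univ)
    refine hst x (hx.mono (erase_subset _ _)) ((hx _ (subset_univ _)).lt_of_ne' fun h0 => ?_)
    have hcard : #((univ : Finset (Fin (m + 1))).erase i) = m := by simp
    rcases m with _ | m
    · rw [card_eq_zero.1 hcard, blossom_empty, hb] at h0
      exact one_ne_zero h0
    · obtain ⟨z, hz, hzpos, hznn⟩ := hN.exists_root hb (m := m) (by lia)
      have hle := hst.blossom_insert_le hb (card_pos.1 (by rw [hcard]; lia)) (notMem_erase i univ)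
        (hcard.symm ▸ hz) (hcard.symm ▸ hzpos) (hx.mono (erase_subset _ _)) h0
      rw [insert_erase (mem_univ i), hcard] at hle
      have hnn := (hx univ subset_rfl).trans hle
      have := appell_pos_of_lt hb (m := m + 1 + 1) (fun j hj => ?_) (hwm z hz)
      · exact this.ne' hw
      · rcases hj.lt_or_eq with hj | rfl
        · exact hznn j (by lia)
        · exact hnn

theorem posSet_poly (c : Fin n → ℝ) :
    posSet (poly n c) = {x | 0 < blossom (codegCoeff c) univ x} := by
  ext x
  simp only [posSet, Set.mem_ofPred_eq, eval_poly]

end InverseSigma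

theorem theorem1p2 (n : ℕ) (hn : 1 ≤ n) (c : Fin n → ℝ) :
    ((∃ G : Set (Fin n → ℝ), InverseSigma.IsConnComponent
          (InverseSigma.posSet (InverseSigma.poly n c)) G ∧ InverseSigma.UpsilonStable G) ↔
      InverseSigma.RightNoetherian (InverseSigma.diagRestriction (InverseSigma.poly n c))) ∧
    (∀ G : Set (Fin n → ℝ), InverseSigma.IsConnComponent
          (InverseSigma.posSet (InverseSigma.poly n c)) G → InverseSigma.UpsilonStable G →
      (InverseSigma.StrictlyUpsilonStable G ↔
        InverseSigma.StrictlyRightNoetherian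
          (InverseSigma.diagRestriction (InverseSigma.poly n c)))) := by
  have hb := InverseSigma.codegCoeff_zero c
  rw [InverseSigma.posSet_poly, InverseSigma.diagRestriction_poly_eq,
    InverseSigma.rightNoetherian_appellPoly hb]
  refine ⟨⟨?_, fun h => ?_⟩, fun G hG hst => ?_⟩
  · rintro ⟨G, hG, hst⟩
    simpa using (hG.stableOn hb hst).appellNoetherian hb
  · exact ⟨_, (h.stableOn hb univ (by simp)).isConnComponent hb,
      InverseSigma.upsilonStable_posOn hb⟩
  · obtain ⟨m, rfl⟩ : ∃ m, n = m + 1 := ⟨n - 1, by lia⟩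
    have hs := hG.stableOn hb hst
    have hN : InverseSigma.AppellNoetherian (InverseSigma.codegCoeff c) (m + 1) := by
      simpa using hs.appellNoetherian hb
    have hiff := hs.frontier_subset_upsilonCone_iff hb
    rw [← hG.eq_posOn hb hst] at hiff
    rw [InverseSigma.strictlyRightNoetherian_appellPoly hb, InverseSigma.StrictlyUpsilonStable,
      hiff]
    simp [hst, hN]
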